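/- A hypergraph $G=(V,E)$ has $n$ vertices and a finite multiset $E$ of $m$ non-empty edges $e\subseteq V$ such that every vertex lies in some edge. Its edges are presented one by one, in an arbitrary order, and the identifier of an edge is the time $t\in\{0,\dots,m-1\}$ of its arrival. Let $\mathrm{OPT}$ be a minimum-cardinality set of edges covering all vertices. For $0<\delta\le 1$, a $\delta$-cover certificate for $G$ is a partial function $\chi$ from $V$ to the identifiers such that $v\in e$ whenever $\chi(v)$ is the identifier of $e$, and such that $|\mathrm{Dom}(\chi)|\ge\delta n$; its image $\mathrm{Im}(\chi)$ is the set of identifiers it takes as values. A randomized one-pass streaming algorithm with $s$ bits of memory is a random choice of a deterministic one; a deterministic one updates an $s$-bit memory image upon each arriving edge, as a function of the edge, its identifier and the current memory image, and after the last edge outputs a partial function from $V$ to identifiers that depends only on the number $m$ of edges and the final memory image. Call it an $(n,s,\epsilon,\rho)$-algorithm if on every $n$-vertex hypergraph with at most $n^2$ edges it outputs, with probability $1$, a $(1-\epsilon)$-cover certificate $\chi$, and $\mathbb{E}\,|\mathrm{Im}(\chi)|\le\rho\cdot|\mathrm{OPT}|$. Theorem. There are a constant $\kappa>0$ and, for every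 $a>0$, a constant $C_a>0$ depending only on $a$, such that for every integer $n_0$ there exists an integer $n\ge n_0$ with the following property: for every $a>0$, every $\epsilon$ with $a/\sqrt{n}\le\epsilon<1$, every $s\le\kappa n^{3/2}$ and every real $\rho$, the existence of an $(n,s,\epsilon,\rho)$-algorithm implies $\rho\ge C_a/\epsilon$. In asymptotic notation: for infinitely many $n$ and every $\epsilon=\Omega(1/\sqrt n)$, $\epsilon<1$, the existence of an $(n,o(n^{3/2}),\epsilon,\rho)$-algorithm implies $\rho=\Omega(1/\epsilon)$. -/

import Mathlib

namespace EdgeCover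

/-- An unweighted hypergraph on the vertex set `Fin n`, together with the order in which its edges
are presented. The edges form a multiset (`edge` need not be injective), each edge is non-empty and
no vertex is isolated. The identifier of an edge is the time `t = 0, …, m - 1` of its arrival. -/
structure Hypergraph (n : ℕ) where
  m : ℕ
  edge : Fin m → Finset (Fin n)
  edge_nonempty : ∀ t, (edge t).Nonempty
  no_isolated : ∀ v, ∃ t, v ∈ edge t

/-- A set `F` of edges covers `G` if every vertex is incident to some edge in `F`. -/
def Hypergraph.Covers {n : ℕ} (G : Hypergraph n) (F : Finset (Fin G.m)) : Prop :=
  ∀ v, ∃ t ∈ F, v ∈ G.edge t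

/-- The cardinality of an optimal edge cover. The set of all edges is a cover, so this is the
minimum of a non-empty set of natural numbers. -/
noncomputable def Hypergraph.opt {n : ℕ} (G : Hypergraph n) : ℕ :=
  sInf {k | ∃ F : Finset (Fin G.m), G.Covers F ∧ F.card = k}

/-- The domain of a partial function from the vertices to edge identifiers. -/
def dom {n : ℕ} (χ : Fin n → Option ℕ) : Finset (Fin n) :=
  Finset.univ.filter fun v => (χ v).isSome

/-- The image of a partial function from the vertices to edge identifiers. -/
def im {n : ℕ} (χ : Fin n → Option ℕ) : Finset ℕ :=
  Finset.univ.biUnion fun v => (χ v).toFinset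

/-- `χ` is a `δ`-cover certificate for `G`: a vertex is only mapped to (identifiers of) edges of
`G` that contain it, and at least `δ n` vertices lie in the domain. -/
def IsCertificate {n : ℕ} (G : Hypergraph n) (δ : ℝ) (χ : Fin n → Option ℕ) : Prop :=
  (∀ v t, χ v = some t → ∃ h : t < G.m, v ∈ G.edge ⟨t, h⟩) ∧
    δ * (n : ℝ) ≤ ((dom χ).card : ℝ)

/-- A deterministic one-pass streaming algorithm on `n` vertices with `s` bits of memory. When the
edge with identifier `t` arrives, the new memory image is a function of `t`, of the edge and of the
old memory image. After the last edge, the output is a function of the number of edges presented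
and of the memory image. The computation within a single step is unrestricted. -/
structure DetAlgorithm (n s : ℕ) where
  init : Fin s → Bool
  step : ℕ → Finset (Fin n) → (Fin s → Bool) → (Fin s → Bool)
  output : ℕ → (Fin s → Bool) → (Fin n → Option ℕ)

/-- The memory image after the edges `edge 0, …, edge (m - 1)` have been presented. -/
def DetAlgorithm.memory {n s : ℕ} (A : DetAlgorithm n s) {m : ℕ}
    (edge : Fin m → Finset (Fin n)) : Fin s → Bool :=
  Fin.foldl m (fun M t => A.step t (edge t) M) A.init

/-- The output of the algorithm on the stream of edges of `G`. -/
def DetAlgorithm.run {n s : ℕ} (A : DetAlgorithm n s) (G : Hypergraph n) : Fin n → Option ℕ :=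
  A.output G.m (A.memory G.edge)

/-- A randomized one-pass streaming algorithm on `n` vertices with `s` bits of memory: a random
choice of a deterministic one, on an arbitrary probability space. (The random bits are not charged
to the memory, so algorithms that toss fresh coins at every step are included.) The output on every
input is a random variable. -/
structure RandAlgorithm (n s : ℕ) where
  Ω : Type*
  [measurableSpace : MeasurableSpace Ω]
  P : MeasureTheory.Measure Ω
  [isProbabilityMeasure : MeasureTheory.IsProbabilityMeasure P]
  alg : Ω → DetAlgorithm n s
  measurableSet_run : ∀ (G : Hypergraph n) (χ : Fin n → Option ℕ),
    MeasurableSet {ω | (alg ω).run G = χ}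

attribute [instance] RandAlgorithm.measurableSpace RandAlgorithm.isProbabilityMeasure

/-- On every `n`-vertex hypergraph with at most `M` edges, the algorithm outputs with probability
`1` a `(1 - ε)`-cover certificate, and the expected cardinality of its image is at most `ρ` times
the cardinality of an optimal edge cover. (The image has at most `n` elements, hence the
expectation is always that of a bounded random variable.) -/
def RandAlgorithm.Guarantees {n s : ℕ} (A : RandAlgorithm n s) (M : ℕ) (ε ρ : ℝ) : Prop :=
  ∀ G : Hypergraph n, G.m ≤ M →
    (∀ᵐ ω ∂A.P, IsCertificate G (1 - ε) ((A.alg ω).run G)) ∧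
      ∫ ω, ((im ((A.alg ω).run G)).card : ℝ) ∂A.P ≤ ρ * (G.opt : ℝ)

end EdgeCover

/-! The vertices are the points of the plane over a field with `q` elements, `n = q ^ 2`. Every
non-vertical line arrives as two halves, split by hidden bits; the last edge is the complement of a
strip of `k ≈ 2εq` parallel lines. The halves of these lines and the last edge form a cover of size
`1 + 2k` (`opt_hardInstance_le`). A certificate may skip only about half of the strip. A strip point
off the axis mapped to a half of its own line reveals a bit; any other line meets the strip in at
most `k` points (`card_im_of_certificate`).

The memory before the last edge determines the outputs for all strips, so for half of the bit
patterns at most `s` bits are revealed in total (`two_pow_card_le_two_mul_card_filter`). Each bit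
serves only `k` strips (`sum_card_revealed_le`), so a typical strip needs order `q` foreign lines,
against `1 + 2k` of order `εq`. Averaging over patterns and strips gives the ratio. -/

namespace EdgeCover

open Finset MeasureTheory

/-! ### Counting functions with certified values -/

/-- At most `2 ^ (|ι| - |K|)` Boolean functions are consistent with a set `K` of prescribed
values. -/
lemma card_consistent_mul_two_pow_le {ι : Type*} [Fintype ι] [DecidableEq ι]
    (K : Finset (ι × Bool)) :
    #{X : ι → Bool | ∀ p ∈ K, X p.1 = p.2} * 2 ^ #K ≤ 2 ^ Fintype.card ι := by
  have h1 : ({X : ι → Bool | ∀ p ∈ K, X p.1 = p.2} : Finset (ι → Bool)) =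
      Fintype.piFinset fun i => ({b | ∀ b', (i, b') ∈ K → b = b'} : Finset Bool) := by
    ext X
    simp
  have h2 : #K = ∑ i, #{b : Bool | (i, b) ∈ K} := by
    rw [card_eq_sum_card_fiberwise (f := Prod.fst) (t := univ) (by simp [Set.MapsTo])]
    refine sum_congr rfl fun i _ => ?_
    refine card_bij' (fun p _ => p.2) (fun b _ => (i, b)) ?_ ?_ ?_ ?_
    · rintro ⟨j, b⟩ h
      simp only [mem_filter] at h
      obtain ⟨h, rfl⟩ := h
      simpa using h
    · simp
    · rintro ⟨j, b⟩ h
      simp only [mem_filter] at h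
      simp [h.2]
    · simp
  rw [h1, Fintype.card_piFinset, h2, ← prod_pow_eq_pow_sum, ← prod_mul_distrib,
    ← Finset.card_univ, ← prod_const]
  refine prod_le_prod' fun i _ => ?_
  -- Contradictory prescriptions leave no function: the factor is `0 * 4`, otherwise `1 * 2` or `2 *
  -- 1`.
  by_cases ht : (i, true) ∈ K <;> by_cases hf : (i, false) ∈ K <;>
    simp [filter_insert, Fintype.univ_bool, ht, hf, filter_singleton]

/-- If each of the `2 ^ s` messages certifies a set of values of the Boolean function that it
encodes, then at least half of the functions have a message that certifies at most `s` values. -/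
lemma two_pow_card_le_two_mul_card_filter {ι T : Type*} [Fintype ι] [DecidableEq ι] [Fintype T]
    [DecidableEq T] {s : ℕ} (hT : Fintype.card T = 2 ^ s) (f : (ι → Bool) → T)
    (K : T → Finset (ι × Bool)) (hK : ∀ X, ∀ p ∈ K (f X), X p.1 = p.2) :
    2 ^ Fintype.card ι ≤ 2 * #{X | #(K (f X)) ≤ s} := by
  have hbad : 2 * #{X | ¬ #(K (f X)) ≤ s} ≤ 2 ^ Fintype.card ι := by
    have h1 : #{X | ¬ #(K (f X)) ≤ s} * 2 ^ (s + 1) ≤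
        ∑ M : T, 2 ^ Fintype.card ι := by
      rw [card_eq_sum_card_fiberwise (f := f) (t := univ) (by simp [Set.MapsTo]), sum_mul]
      refine sum_le_sum fun M _ => ?_
      by_cases hM : #(K M) ≤ s
      · rw [filter_filter, filter_false_of_mem]
        · simp
        · rintro X - ⟨hX, rfl⟩
          exact hX hM
      · refine le_trans (Nat.mul_le_mul (card_le_card ?_)
          (Nat.pow_le_pow_right two_pos (Nat.lt_of_not_le hM)))
          (card_consistent_mul_two_pow_le (K M))
        intro X hX
        simp only [mem_filter, mem_univ, true_and] at hX ⊢
        exact fun p hp => hK X p (hX.2 ▸ hp)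
    rw [sum_const, Finset.card_univ, hT, smul_eq_mul, pow_succ] at h1
    have := Nat.pow_pos (n := s) two_pos
    refine Nat.le_of_mul_le_mul_left ?_ this
    linarith
  have htot := card_filter_add_card_filter_not (s := (univ : Finset (ι → Bool)))
    (fun X => #(K (f X)) ≤ s)
  rw [Finset.card_univ, Fintype.card_fun, Fintype.card_bool] at htot
  omega

/-! ### The hard instance and its certificates -/

section HardInstance

variable {F : Type*} [Field F] [DecidableEq F] {n L : ℕ}

/-- The points of the line with slope `i.1.1` and intercept `i.1.2` whose bit is `i.2`, together
with the point of this line on the second axis. -/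
def lineEdge (e : Fin n ≃ F × F) (X : (F × F) × F → Bool) (i : (F × F) × Bool) :
    Finset (Fin n) :=
  {v | (e v).2 = i.1.1 * (e v).1 + i.1.2 ∧ ((e v).1 = 0 ∨ X (i.1, (e v).1) = i.2)}

/-- The union of the lines with slope `c.1` whose intercepts lie in `c.2 + S`. -/
def strip (e : Fin n ≃ F × F) (S : Finset F) (c : F × F) : Finset (Fin n) :=
  {v | (e v).2 - c.1 * (e v).1 - c.2 ∈ S}

/-- The stream of edges that presents both halves of every line, and finally the complement of a
strip. -/
def hardEdges (e : Fin n ≃ F × F) (g : Fin L ≃ (F × F) × Bool) (S : Finset F)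
    (X : (F × F) × F → Bool) (c : F × F) : Fin (L + 1) → Finset (Fin n) :=
  Fin.snoc (α := fun _ => Finset (Fin n)) (fun j => lineEdge e X (g j)) (strip e S c)ᶜ

lemma mem_lineEdge_self (e : Fin n ≃ F × F) (X : (F × F) × F → Bool) (α : F) (v : Fin n) :
    v ∈ lineEdge e X ((α, (e v).2 - α * (e v).1),
      X ((α, (e v).2 - α * (e v).1), (e v).1)) := by
  simp [lineEdge]

lemma card_strip_axis_le (e : Fin n ≃ F × F) (S : Finset F) (c : F × F) :
    #{v ∈ strip e S c | (e v).1 = 0} ≤ #S := by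
  refine card_le_card_of_injOn (fun v => (e v).2 - c.1 * (e v).1 - c.2) ?_ ?_
  · intro v hv
    simp only [strip, coe_filter, mem_filter, mem_univ, true_and, Set.mem_ofPred_eq] at hv
    exact hv.1
  · intro v hv w hw h
    simp only [coe_filter, Set.mem_ofPred_eq] at hv hw
    refine e.injective (Prod.ext (hv.2.trans hw.2.symm) ?_)
    simpa [hv.2, hw.2] using h

/-- A line that is not parallel to the strip meets it in at most `|S|` points. -/
lemma card_strip_inter_line_le (e : Fin n ≃ F × F) (S : Finset F) (c l : F × F) (h : l.1 ≠ c.1) :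
    #{v ∈ strip e S c | (e v).2 = l.1 * (e v).1 + l.2} ≤ #S := by
  refine card_le_card_of_injOn (fun v => (e v).2 - c.1 * (e v).1 - c.2) ?_ ?_
  · intro v hv
    simp only [strip, coe_filter, mem_filter, mem_univ, true_and, Set.mem_ofPred_eq] at hv
    exact hv.1
  · intro v hv w hw hvw
    simp only [coe_filter, Set.mem_ofPred_eq] at hv hw
    have h1 : (l.1 - c.1) * ((e v).1 - (e w).1) = 0 := by
      have := hvw
      simp only [hv.2, hw.2] at this
      linear_combination this
    have h2 : (e v).1 = (e w).1 := by
      rcases mul_eq_zero.1 h1 with h3 | h3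
      · exact absurd (sub_eq_zero.1 h3) h
      · exact sub_eq_zero.1 h3
    exact e.injective (Prod.ext h2 (by rw [hv.2, hw.2, h2]))

variable [Fintype F]

/-- The hypergraph with edges `hardEdges`. -/
def hardInstance (e : Fin n ≃ F × F) (g : Fin L ≃ (F × F) × Bool) (S : Finset F)
    (hS : S ≠ univ) (X : (F × F) × F → Bool) (c : F × F) : Hypergraph n where
  m := L + 1
  edge := hardEdges e g S X c
  edge_nonempty t := by
    induction t using Fin.lastCases with
    | last =>
      obtain ⟨y, hy⟩ : ∃ y, y ∉ S := by simpa [eq_univ_iff_forall] using hS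
      refine ⟨e.symm (0, y + c.2), ?_⟩
      simpa [hardEdges, strip] using hy
    | cast j =>
      -- The axis point lies in both halves, so neither is empty, whatever the bits are.
      refine ⟨e.symm (0, (g j).1.2), ?_⟩
      simp [hardEdges, lineEdge]
  no_isolated v := by
    refine ⟨(g.symm ((0, (e v).2 - 0 * (e v).1), X ((0, (e v).2 - 0 * (e v).1), (e v).1))).castSucc,
      ?_⟩
    simp only [hardEdges, Fin.snoc_castSucc, Equiv.apply_symm_apply]
    exact mem_lineEdge_self e X 0 v

lemma opt_hardInstance_le (e : Fin n ≃ F × F) (g : Fin L ≃ (F × F) × Bool) (S : Finset F)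
    (hS : S ≠ univ) (X : (F × F) × F → Bool) (c : F × F) :
    (hardInstance e g S hS X c).opt ≤ 1 + 2 * #S := by
  let T : Finset (Fin (L + 1)) := insert (Fin.last L)
    ((S ×ˢ univ).image fun p : F × Bool => (g.symm ((c.1, c.2 + p.1), p.2)).castSucc)
  have hT : #T ≤ 1 + 2 * #S := by
    refine (card_insert_le _ _).trans ?_
    have : #((S ×ˢ univ).image fun p : F × Bool => (g.symm ((c.1, c.2 + p.1), p.2)).castSucc) ≤
      #S * 2 := card_image_le.trans (by simp [card_product])
    omega
  refine le_trans (Nat.sInf_le ⟨T, fun v => ?_, rfl⟩) hT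
  by_cases hv : v ∈ strip e S c
  · refine ⟨(g.symm ((c.1, (e v).2 - c.1 * (e v).1),
      X ((c.1, (e v).2 - c.1 * (e v).1), (e v).1))).castSucc, ?_, ?_⟩
    · refine mem_insert_of_mem (mem_image.2 ⟨((e v).2 - c.1 * (e v).1 - c.2,
        X ((c.1, (e v).2 - c.1 * (e v).1), (e v).1)), ?_, ?_⟩)
      · simpa [strip] using hv
      · simp only [add_sub_cancel]
        rfl
    · simp only [hardInstance, hardEdges, Fin.snoc_castSucc, Equiv.apply_symm_apply]
      exact mem_lineEdge_self e X c.1 v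
  · exact ⟨Fin.last L, mem_insert_self _ _, by simpa [hardInstance, hardEdges] using hv⟩

lemma card_strip (e : Fin n ≃ F × F) (S : Finset F) (c : F × F) :
    #(strip e S c) = Fintype.card F * #S := by
  rw [← Finset.card_univ, ← card_product]
  refine card_bij' (fun v _ => ((e v).1, (e v).2 - c.1 * (e v).1 - c.2))
    (fun p _ => e.symm (p.1, p.2 + c.2 + c.1 * p.1)) ?_ ?_ ?_ ?_
  · simp [strip]
  · simp [strip]
  · intro v _
    simp
  · simp

/-- The points of the strip, off the second axis, which `χ` maps to a half of their own line. -/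
def revealed (e : Fin n ≃ F × F) (g : Fin L ≃ (F × F) × Bool) (S : Finset F) (c : F × F)
    (χ : Fin n → Option ℕ) : Finset (Fin n) :=
  {v ∈ strip e S c | (e v).1 ≠ 0 ∧
    ∃ b, χ v = some (g.symm ((c.1, (e v).2 - c.1 * (e v).1), b) : ℕ)}

/-- This is how outputs reveal bits: off the axis, membership in a half of a line determines `X`
there. -/
lemma mem_lineEdge_of_certificate {e : Fin n ≃ F × F} {g : Fin L ≃ (F × F) × Bool} {S : Finset F}
    {hS : S ≠ univ} {X : (F × F) × F → Bool} {c : F × F} {δ : ℝ} {χ : Fin n → Option ℕ}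
    (hχ : IsCertificate (hardInstance e g S hS X c) δ χ) {v : Fin n} {i : (F × F) × Bool}
    (h : χ v = some (g.symm i : ℕ)) : v ∈ lineEdge e X i := by
  obtain ⟨ht, hv⟩ := hχ.1 v _ h
  have : (⟨(g.symm i : ℕ), ht⟩ : Fin (L + 1)) = (g.symm i).castSucc := rfl
  simp only [hardInstance] at hv
  erw [this] at hv
  simpa [hardEdges] using hv

lemma exists_line_of_certificate {e : Fin n ≃ F × F} {g : Fin L ≃ (F × F) × Bool} {S : Finset F}
    {hS : S ≠ univ} {X : (F × F) × F → Bool} {c : F × F} {δ : ℝ} {χ : Fin n → Option ℕ}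
    (hχ : IsCertificate (hardInstance e g S hS X c) δ χ) {v : Fin n} (hv : v ∈ strip e S c)
    {t : ℕ} (h : χ v = some t) : ∃ i, t = (g.symm i : ℕ) := by
  obtain ⟨ht, hv'⟩ := hχ.1 v t h
  change t < L + 1 at ht
  change v ∈ hardEdges e g S X c ⟨t, ht⟩ at hv'
  rcases Nat.lt_succ_iff_lt_or_eq.1 ht with h1 | rfl
  · exact ⟨g ⟨t, h1⟩, by simp⟩
  · have : (⟨t, ht⟩ : Fin (t + 1)) = Fin.last t := rfl
    rw [this] at hv'
    simp [hardEdges, hv] at hv'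

/-- The image of a certificate is large unless many points are mapped to their own line. -/
lemma card_im_of_certificate {e : Fin n ≃ F × F} {g : Fin L ≃ (F × F) × Bool} {S : Finset F}
    {hS : S ≠ univ} {X : (F × F) × F → Bool} {c : F × F} {ε : ℝ} {χ : Fin n → Option ℕ}
    (hχ : IsCertificate (hardInstance e g S hS X c) (1 - ε) χ) :
    (Fintype.card F * #S : ℝ) - ε * n - #S - #(revealed e g S c χ) ≤ #S * #(im χ) := by
  set other : Finset (Fin n) := {v ∈ strip e S c | ∃ i : (F × F) × Bool, i.1.1 ≠ c.1 ∧
    χ v = some (g.symm i : ℕ)} with hother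
  have h1 : strip e S c ⊆ (dom χ)ᶜ ∪ ({v ∈ strip e S c | (e v).1 = 0} ∪
      (revealed e g S c χ ∪ other)) := by
    intro v hv
    by_cases hd : v ∈ dom χ
    swap
    · exact mem_union_left _ (mem_compl.2 hd)
    refine mem_union_right _ ?_
    by_cases h0 : (e v).1 = 0
    · exact mem_union_left _ (mem_filter.2 ⟨hv, h0⟩)
    refine mem_union_right _ ?_
    obtain ⟨t, ht⟩ := Option.isSome_iff_exists.1 (by simpa [dom] using hd)
    obtain ⟨i, rfl⟩ := exists_line_of_certificate hχ hv ht
    by_cases hi : i.1.1 = c.1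
    · refine mem_union_left _ (mem_filter.2 ⟨hv, h0, i.2, ?_⟩)
      have := mem_lineEdge_of_certificate hχ ht
      simp only [lineEdge, mem_filter, mem_univ, true_and] at this
      have h2 : (c.1, (e v).2 - c.1 * (e v).1) = i.1 :=
        Prod.ext hi.symm (by rw [this.1, hi]; simp)
      rw [ht, h2]
    · exact mem_union_right _ (mem_filter.2 ⟨hv, i, hi, ht⟩)
  have h2 : #other ≤ #S * #(im χ) := by
    refine card_le_mul_card_image_of_maps_to (f := fun v => (χ v).getD 0) ?_ _ ?_
    · intro v hv
      obtain ⟨-, i, -, hi⟩ := mem_filter.1 hv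
      exact mem_biUnion.2 ⟨v, mem_univ _, by simp [hi]⟩
    · intro t _
      by_cases hne : ({v ∈ other | (χ v).getD 0 = t} : Finset (Fin n)).Nonempty
      swap
      · rw [not_nonempty_iff_eq_empty.1 hne]
        simp
      obtain ⟨w, hw⟩ := hne
      obtain ⟨hw, hwt⟩ := mem_filter.1 hw
      obtain ⟨-, i, hi, hwi⟩ := mem_filter.1 hw
      -- All points sharing this identifier lie on one line transversal to the strip.
      refine le_trans (card_le_card fun v hv => ?_) (card_strip_inter_line_le e S c i.1 hi)
      obtain ⟨hv, hvt⟩ := mem_filter.1 hv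
      obtain ⟨hvs, j, hj, hvj⟩ := mem_filter.1 hv
      have hij : χ v = some (g.symm i : ℕ) := by
        rw [hvj, Option.getD_some] at hvt
        rw [hwi, Option.getD_some] at hwt
        rw [hvj, hvt, hwt]
      have := mem_lineEdge_of_certificate hχ hij
      simp only [lineEdge, mem_filter, mem_univ, true_and] at this
      exact mem_filter.2 ⟨hvs, this.1⟩
  have h3 := (card_le_card h1).trans ((card_union_le _ _).trans (Nat.add_le_add_left
    ((card_union_le _ _).trans (Nat.add_le_add_left (card_union_le _ _) _)) _))
  rw [card_strip] at h3
  have h4 := card_strip_axis_le e S c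
  have h5 : #(dom χ)ᶜ + #(dom χ) = n := by
    rw [card_compl_add_card, Fintype.card_fin]
  have h6 := hχ.2
  rify at h2 h3 h4 h5
  linarith

/-! ### Averaging over bits and strips -/

/-- The output on `hardInstance` as a function of the memory image before the last edge. -/
def outputAfter {s : ℕ} (A : DetAlgorithm n s) (L : ℕ) (e : Fin n ≃ F × F) (S : Finset F)
    (c : F × F) (M : Fin s → Bool) : Fin n → Option ℕ :=
  A.output (L + 1) (A.step L (strip e S c)ᶜ M)

/-- The bits that the outputs for the various strips certify, given the memory image before the
last edge. -/
def knownBits {s : ℕ} (A : DetAlgorithm n s) (e : Fin n ≃ F × F) (g : Fin L ≃ (F × F) × Bool)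
    (S : Finset F) (M : Fin s → Bool) : Finset (((F × F) × F) × Bool) :=
  {p | p.1.2 ≠ 0 ∧ ∃ c, outputAfter A L e S c M
    (e.symm (p.1.2, p.1.1.1 * p.1.2 + p.1.1.2)) = some (g.symm (p.1.1, p.2) : ℕ)}

lemma run_hardInstance {s : ℕ} (A : DetAlgorithm n s) (e : Fin n ≃ F × F)
    (g : Fin L ≃ (F × F) × Bool) (S : Finset F) (hS : S ≠ univ) (X : (F × F) × F → Bool)
    (c : F × F) : A.run (hardInstance e g S hS X c) =
      outputAfter A L e S c (A.memory fun j => lineEdge e X (g j)) := by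
  simp [DetAlgorithm.run, hardInstance, outputAfter, DetAlgorithm.memory, Fin.foldl_succ_last,
    hardEdges]

/-- A revealed bit fixes the slope and the point; the offset of the point in `S` then fixes the
strip. Hence each bit is counted at most `#S` times. -/
lemma sum_card_revealed_le {s : ℕ} (A : DetAlgorithm n s) (e : Fin n ≃ F × F)
    (g : Fin L ≃ (F × F) × Bool) (S : Finset F) (M : Fin s → Bool) :
    ∑ c, #(revealed e g S c (outputAfter A L e S c M)) ≤ #S * #(knownBits A e g S M) := by
  rw [← card_sigma]
  refine le_trans ?_ (Nat.mul_le_mul_left _ (card_image_le (f := Prod.fst)))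
  rw [← card_product]
  refine card_le_card_of_injOn (fun p => ((e p.2).2 - p.1.1 * (e p.2).1 - p.1.2,
    ((p.1.1, (e p.2).2 - p.1.1 * (e p.2).1), (e p.2).1))) ?_ ?_
  · rintro ⟨c, v⟩ hp
    simp only [coe_sigma, Set.mem_sigma_iff, coe_univ, Set.mem_univ, true_and, mem_coe,
      revealed, mem_filter] at hp
    obtain ⟨hv, h0, b, hb⟩ := hp
    refine mem_coe.2 (mem_product.2 ⟨by simpa [strip] using hv, mem_image.2
      ⟨(((c.1, (e v).2 - c.1 * (e v).1), (e v).1), b), ?_, rfl⟩⟩)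
    refine mem_filter.2 ⟨mem_univ _, h0, c, ?_⟩
    simpa using hb
  · rintro ⟨⟨α, β⟩, v⟩ - ⟨⟨α', β'⟩, w⟩ - h
    simp only [Prod.mk.injEq] at h
    obtain ⟨h1, ⟨rfl, h2⟩, h3⟩ := h
    have hvw : v = w := e.injective (Prod.ext h3 (by rw [h3] at h2; exact sub_left_injective h2))
    subst hvw
    simp only [sub_right_inj] at h1
    rw [h1]

/-- A correct deterministic algorithm outputs large covers on average. -/
lemma sum_card_im_of_certificates {s : ℕ} (A : DetAlgorithm n s) (e : Fin n ≃ F × F)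
    (g : Fin L ≃ (F × F) × Bool) (S : Finset F) (hS : S ≠ univ) {ε : ℝ}
    (hA : ∀ X c, IsCertificate (hardInstance e g S hS X c) (1 - ε)
      (A.run (hardInstance e g S hS X c)))
    (hpos : 0 ≤ (Fintype.card F : ℝ) ^ 2 * (Fintype.card F * #S - ε * n - #S) - #S * s) :
    (2 : ℝ) ^ Fintype.card ((F × F) × F) *
      ((Fintype.card F : ℝ) ^ 2 * (Fintype.card F * #S - ε * n - #S) - #S * s) ≤
      2 * (#S * ∑ X, ∑ c, (#(im (A.run (hardInstance e g S hS X c))) : ℝ)) := by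
  set B := (Fintype.card F : ℝ) ^ 2 * (Fintype.card F * #S - ε * n - #S) - #S * s with hB
  set mem : ((F × F) × F → Bool) → (Fin s → Bool) := fun X =>
    A.memory fun j => lineEdge e X (g j)
  have hhalf := two_pow_card_le_two_mul_card_filter (s := s) (by simp) mem (knownBits A e g S) (by
    rintro X ⟨⟨l, x⟩, b⟩ hp
    obtain ⟨-, h0, c, hc⟩ := mem_filter.1 hp
    rw [← run_hardInstance A e g S hS X c] at hc
    have := mem_lineEdge_of_certificate (hA X c) hc
    simp only [lineEdge, mem_filter, mem_univ, true_and, Equiv.apply_symm_apply] at this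
    exact this.resolve_left h0)
  have hX : ∀ X ∈ ({X | #(knownBits A e g S (mem X)) ≤ s} : Finset ((F × F) × F → Bool)),
      B ≤ #S * ∑ c, (#(im (A.run (hardInstance e g S hS X c))) : ℝ) := by
    intro X hXs
    have h1 : ∑ c, #(revealed e g S c (A.run (hardInstance e g S hS X c))) ≤ #S * s := by
      simp_rw [run_hardInstance]
      exact (sum_card_revealed_le A e g S (mem X)).trans
        (Nat.mul_le_mul_left _ (mem_filter.1 hXs).2)
    have h2 := sum_le_sum fun c (_ : c ∈ univ) => card_im_of_certificate (hA X c)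
    rw [← mul_sum, sum_sub_distrib] at h2
    simp only [sum_const, Finset.card_univ, Fintype.card_prod, nsmul_eq_mul] at h2
    rify at h1
    push_cast at h2
    rw [hB]
    linarith
  have hsum : (#{X | #(knownBits A e g S (mem X)) ≤ s} : ℝ) * B ≤
      #S * ∑ X, ∑ c, (#(im (A.run (hardInstance e g S hS X c))) : ℝ) := by
    rw [← nsmul_eq_mul, ← sum_const, mul_sum]
    refine (sum_le_sum hX).trans (sum_le_sum_of_subset_of_nonneg (subset_univ _) ?_)
    exact fun X _ _ => mul_nonneg (Nat.cast_nonneg _) (sum_nonneg fun c _ => Nat.cast_nonneg _)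
  have hhalf' : (2 : ℝ) ^ Fintype.card ((F × F) × F) ≤
      2 * (#{X | #(knownBits A e g S (mem X)) ≤ s} : ℝ) := by exact_mod_cast hhalf
  refine (mul_le_mul_of_nonneg_right hhalf' hpos).trans ?_
  rw [mul_assoc]
  exact mul_le_mul_of_nonneg_left hsum two_pos.le

end HardInstance

/-! ### Randomized algorithms -/

lemma card_im_le {n : ℕ} (χ : Fin n → Option ℕ) : #(im χ) ≤ n := by
  refine card_biUnion_le.trans ((sum_le_card_nsmul _ _ 1 fun v _ => ?_).trans (by simp))
  cases χ v <;> simp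

/-- There are only countably many outputs, so measurability of each output event suffices. -/
lemma RandAlgorithm.integrable_card_im {n s : ℕ} (A : RandAlgorithm n s) (G : Hypergraph n) :
    Integrable (fun ω => (#(im ((A.alg ω).run G)) : ℝ)) A.P := by
  let _ : MeasurableSpace (Fin n → Option ℕ) := ⊤
  have h1 : Measurable fun ω => (A.alg ω).run G :=
    measurable_to_countable' fun χ => A.measurableSet_run G χ
  have h2 : Measurable fun ω => (#(im ((A.alg ω).run G)) : ℝ) :=
    (measurable_from_top (f := fun χ : Fin n → Option ℕ => (#(im χ) : ℝ))).comp h1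
  refine Integrable.of_bound h2.aestronglyMeasurable (n : ℝ) (ae_of_all _ fun ω => ?_)
  simpa using card_im_le _

lemma one_le_card_im {n : ℕ} (hn : 0 < n) {G : Hypergraph n} {ε : ℝ} (hε : ε < 1)
    {χ : Fin n → Option ℕ} (hχ : IsCertificate G (1 - ε) χ) : 1 ≤ #(im χ) := by
  have h1 : (0 : ℝ) < #(dom χ) :=
    lt_of_lt_of_le (mul_pos (sub_pos.2 hε) (Nat.cast_pos.2 hn)) hχ.2
  obtain ⟨v, hv⟩ := card_pos.1 (Nat.cast_pos.1 h1)
  obtain ⟨t, ht⟩ := Option.isSome_iff_exists.1 (by simpa [dom] using hv)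
  exact card_pos.2 ⟨t, mem_biUnion.2 ⟨v, mem_univ _, by simp [ht]⟩⟩

/-- No algorithm beats the optimum on the hypergraph with a single edge. -/
lemma RandAlgorithm.Guarantees.one_le {n s M : ℕ} (hn : 0 < n) (hM : 1 ≤ M) {ε ρ : ℝ}
    (hε : ε < 1) {A : RandAlgorithm n s} (hA : A.Guarantees M ε ρ) : 1 ≤ ρ := by
  let G : Hypergraph n :=
    { m := 1
      edge := fun _ => univ
      edge_nonempty := fun _ => ⟨⟨0, hn⟩, mem_univ _⟩
      no_isolated := fun v => ⟨0, mem_univ _⟩ }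
  have hopt : G.opt ≤ 1 := Nat.sInf_le ⟨univ, fun v => ⟨0, mem_univ _, mem_univ _⟩, by simp [G]⟩
  obtain ⟨h1, h2⟩ := hA G hM
  have h3 : (1 : ℝ) ≤ ∫ ω, (#(im ((A.alg ω).run G)) : ℝ) ∂A.P := by
    have := integral_mono_ae (integrable_const (1 : ℝ)) (A.integrable_card_im G)
      (h1.mono fun ω hω => Nat.one_le_cast.2 (one_le_card_im hn hε hω))
    simpa using this
  have h4 := h3.trans h2
  interval_cases h : G.opt
  · norm_num at h4
  · simpa using h4

lemma RandAlgorithm.Guarantees.mono {n s M : ℕ} {ε ε' ρ : ℝ} (h : ε ≤ ε')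
    {A : RandAlgorithm n s} (hA : A.Guarantees M ε ρ) : A.Guarantees M ε' ρ := fun G hG =>
  ⟨(hA G hG).1.mono fun _ hω => ⟨hω.1, le_trans (by gcongr) hω.2⟩, (hA G hG).2⟩

/-- The approximation ratio of a randomized algorithm, bounded in terms of the number `|S|` of
parallel lines in the strip. -/
lemma RandAlgorithm.Guarantees.le_ratio {F : Type*} [Field F] [Fintype F] [DecidableEq F]
    {n s M : ℕ} (e : Fin n ≃ F × F) (S : Finset F) (hS : S ≠ univ) {ε ρ : ℝ} (hρ : 0 ≤ ρ)
    (hM : 2 * n + 1 ≤ M) {A : RandAlgorithm n s} (hA : A.Guarantees M ε ρ)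
    (hpos : 0 ≤ (Fintype.card F : ℝ) ^ 2 * (Fintype.card F * #S - ε * n - #S) - #S * s) :
    (Fintype.card F : ℝ) ^ 2 * (Fintype.card F * #S - ε * n - #S) - #S * s ≤
      2 * (#S * ((Fintype.card F : ℝ) ^ 2 * (ρ * (1 + 2 * #S)))) := by
  have hcard : Fintype.card ((F × F) × Bool) = 2 * n := by
    rw [Fintype.card_prod, ← Fintype.card_congr e]
    simp [mul_comm]
  let g : Fin (2 * n) ≃ (F × F) × Bool := (Fintype.equivFinOfCardEq hcard).symm
  have hG := fun X c => hA (hardInstance e g S hS X c) hM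
  -- Finitely many instances, so almost surely all certificates are valid at once.
  have h1 : ∀ᵐ ω ∂A.P, ∀ X c, IsCertificate (hardInstance e g S hS X c) (1 - ε)
      ((A.alg ω).run (hardInstance e g S hS X c)) :=
    ae_all_iff.2 fun X => ae_all_iff.2 fun c => (hG X c).1
  have hint : ∀ X c, Integrable
      (fun ω => (#(im ((A.alg ω).run (hardInstance e g S hS X c))) : ℝ)) A.P :=
    fun X c => A.integrable_card_im _
  have hint2 : ∀ X, Integrable
      (fun ω => ∑ c, (#(im ((A.alg ω).run (hardInstance e g S hS X c))) : ℝ)) A.P :=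
    fun X => integrable_finsetSum _ fun c _ => hint X c
  have h2 := integral_mono_ae (integrable_const _)
    (((integrable_finsetSum univ fun X _ => hint2 X).const_mul (#S : ℝ)).const_mul 2)
    (h1.mono fun ω hω => sum_card_im_of_certificates (A.alg ω) e g S hS hω hpos)
  rw [integral_const, probReal_univ, one_smul, integral_const_mul, integral_const_mul,
    integral_finsetSum _ fun X _ => hint2 X] at h2
  have h3 : ∑ X, ∫ ω, ∑ c, (#(im ((A.alg ω).run (hardInstance e g S hS X c))) : ℝ) ∂A.P ≤
      2 ^ Fintype.card ((F × F) × F) *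
        ((Fintype.card F : ℝ) ^ 2 * (ρ * (1 + 2 * #S))) := by
    have h4 : ∀ X c, ∫ ω, (#(im ((A.alg ω).run (hardInstance e g S hS X c))) : ℝ) ∂A.P ≤
        ρ * (1 + 2 * #S) := fun X c => (hG X c).2.trans
      (mul_le_mul_of_nonneg_left (by exact_mod_cast opt_hardInstance_le e g S hS X c) hρ)
    calc _ ≤ ∑ X : (F × F) × F → Bool, ∑ c : F × F, ρ * (1 + 2 * (#S : ℝ)) := by
          refine sum_le_sum fun X _ => ?_
          rw [integral_finsetSum _ fun c _ => hint X c]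
          exact sum_le_sum fun c _ => h4 X c
      _ = _ := by
          simp only [sum_const, Finset.card_univ, Fintype.card_fun, Fintype.card_bool,
            nsmul_eq_mul]
          rw [Fintype.card_prod F F]
          push_cast
          ring
  have h5 : (0 : ℝ) < 2 ^ Fintype.card ((F × F) × F) := by positivity
  refine le_of_mul_le_mul_left (h2.trans ?_) h5
  refine (mul_le_mul_of_nonneg_left (mul_le_mul_of_nonneg_left h3 (Nat.cast_nonneg _))
    two_pos.le).trans (le_of_eq ?_)
  ring

/-! ### Choice of parameters -/

/-- The lower bound for `n = q ^ 2` with a prime `q`, when `ε ≥ 1 / q`. -/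
lemma RandAlgorithm.Guarantees.inv_le_of_prime {q s : ℕ} (hq : q.Prime) (hq8 : 8 ≤ q) {ε ρ : ℝ}
    (hε : 1 ≤ ε * q) (hε1 : ε < 1) (hs : (s : ℝ) ≤ 1 / 8 * (q : ℝ) ^ 3)
    {A : RandAlgorithm (q ^ 2) s} (hA : A.Guarantees ((q ^ 2) ^ 2) ε ρ) : 1 / 56 / ε ≤ ρ := by
  have hq0 : (8 : ℝ) ≤ q := by exact_mod_cast hq8
  have hε0 : 0 < ε := pos_of_mul_pos_left (by linarith) (Nat.cast_nonneg q)
  have hM : 2 * q ^ 2 + 1 ≤ (q ^ 2) ^ 2 := by nlinarith [Nat.mul_le_mul hq8 hq8]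
  have hρ1 : 1 ≤ ρ := hA.one_le (by positivity) (by omega) hε1
  rw [div_le_iff₀ hε0]
  rcases le_or_gt (1 / 3) ε with h3 | h3
  · nlinarith
  have : Fact q.Prime := ⟨hq⟩
  -- The strip then has `q * k ≥ 2 * ε * n` points, twice what may be left uncovered.
  set k := ⌈2 * ε * q⌉₊ with hk
  have hk1 : 2 * ε * q ≤ k := Nat.le_ceil _
  have hk2 : (k : ℝ) < 2 * ε * q + 1 := Nat.ceil_lt_add_one (by positivity)
  have hkq : k < q := by
    have : (k : ℝ) < q := by nlinarith
    exact_mod_cast this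
  obtain ⟨S, -, hS⟩ := exists_subset_card_eq (s := (univ : Finset (ZMod q))) (n := k)
    (by simp [ZMod.card, hkq.le])
  have hSu : S ≠ univ := by
    rintro rfl
    simp [ZMod.card] at hS
    omega
  have e : Fin (q ^ 2) ≃ ZMod q × ZMod q :=
    (Fintype.equivFinOfCardEq (by simp [ZMod.card, sq])).symm
  have hk0 : (0 : ℝ) < k := by nlinarith
  -- The losses are `1/2` (uncovered), `1/8` (axis, as `q ≥ 8`) and `1/8` (memory), leaving `1/4`.
  have hlow : (k : ℝ) * (q ^ 3 / 4) ≤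
      (q : ℝ) ^ 2 * (q * k - ε * (q ^ 2 : ℕ) - k) - k * s := by
    have h1 : ε * (q : ℝ) ^ 2 ≤ k * q / 2 := by nlinarith
    have h2 : (k : ℝ) ≤ k * q / 8 := by nlinarith
    have h3 : (k : ℝ) * s ≤ k * (1 / 8 * (q : ℝ) ^ 3) := by gcongr
    have h4 : (q : ℝ) ^ 2 * (q * k - k * q / 2 - k * q / 8) ≤
        (q : ℝ) ^ 2 * (q * k - ε * (q : ℝ) ^ 2 - k) := by gcongr
    push_cast
    nlinarith
  have h := hA.le_ratio e S hSu (by linarith) hM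
    (by rw [ZMod.card, hS]; exact le_trans (by positivity) hlow)
  rw [ZMod.card, hS] at h
  have h5 : (k : ℝ) * (q : ℝ) ^ 2 * (q / 8) ≤ k * (q : ℝ) ^ 2 * (ρ * (1 + 2 * k)) := by
    linarith [hlow.trans h]
  have h6 := le_of_mul_le_mul_left h5 (by positivity)
  -- `1 + 2k ≤ 3 + 4εq ≤ 7εq`, because `εq ≥ 1`.
  have h7 : ρ * (1 + 2 * k) ≤ ρ * (7 * (ε * q)) := by gcongr; linarith
  have h8 : (q : ℝ) * (1 / 56) ≤ q * (ρ * ε) := by linarith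
  exact le_of_mul_le_mul_left h8 (by linarith)

end EdgeCover

/-- Lower bound for certified streaming edge cover. Here `κ` is the constant hidden in the memory
bound `o(n ^ (3/2))`, `a` the one in `ε = Ω(1/√n)`, and `C a`, which depends on `a` only, the one
in `ρ = Ω(1/ε)`. -/
theorem mainTheorem5 :
    ∃ κ : ℝ, 0 < κ ∧ ∃ C : ℝ → ℝ, (∀ a : ℝ, 0 < a → 0 < C a) ∧
      ∀ n₀ : ℕ, ∃ n : ℕ, n₀ ≤ n ∧
        ∀ a : ℝ, 0 < a → ∀ ε : ℝ, a / √(n : ℝ) ≤ ε → ε < 1 →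
          ∀ (s : ℕ) (ρ : ℝ), (s : ℝ) ≤ κ * (n : ℝ) ^ (3 / 2 : ℝ) →
            (∃ A : EdgeCover.RandAlgorithm n s, A.Guarantees (n ^ 2) ε ρ) → C a / ε ≤ ρ := by
  refine ⟨1 / 8, by norm_num, fun a => min 1 a / 56, fun a ha => by positivity, fun n₀ => ?_⟩
  obtain ⟨q, hq, hqp⟩ := Nat.exists_infinite_primes (n₀ + 8)
  refine ⟨q ^ 2, by nlinarith, ?_⟩
  rintro a ha ε hε hε1 s ρ hs ⟨A, hA⟩
  have hq8 : (8 : ℝ) ≤ q := by exact_mod_cast (by omega : 8 ≤ q)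
  have hq0 : (0 : ℝ) < q := by linarith
  have hsqrt : √((q ^ 2 : ℕ) : ℝ) = q := by
    push_cast
    exact Real.sqrt_sq hq0.le
  have hpow : ((q ^ 2 : ℕ) : ℝ) ^ (3 / 2 : ℝ) = (q : ℝ) ^ 3 := by
    push_cast
    rw [← Real.rpow_natCast_mul hq0.le, ← Real.rpow_natCast]
    norm_num
  rw [hsqrt] at hε
  rw [hpow] at hs
  have hε0 : 0 < ε := lt_of_lt_of_le (by positivity) hε
  -- An `ε` below `1 / q` is raised to `1 / q`; as `a / q ≤ ε`, this costs at most the factor `min 1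
  -- a`.
  have hmain : 1 / 56 / max ε (1 / q) ≤ ρ := by
    refine (hA.mono (le_max_left ε (1 / q))).inv_le_of_prime hqp (by omega) ?_ ?_ hs
    · rw [← div_le_iff₀ hq0]
      exact le_max_right _ _
    · refine max_lt hε1 ?_
      rw [div_lt_one hq0]
      linarith
  refine le_trans ?_ hmain
  rw [div_le_div_iff₀ hε0 (by positivity)]
  have h1 : min 1 a * max ε (1 / q) ≤ ε := by
    rcases max_cases ε (1 / (q : ℝ)) with ⟨h, -⟩ | ⟨h, -⟩ <;> rw [h]
    · exact mul_le_of_le_one_left hε0.le (min_le_left _ _)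
    · refine le_trans (mul_le_mul_of_nonneg_right (min_le_right 1 a) (by positivity)) ?_
      rwa [mul_one_div]
  linarith
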